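/- A \emph{dependency structure with choice} (DSC) is a pair $(E,D)$ where $E$ is a finite set of events and $D$ assigns to each $e\in E$ a nonempty collection $D(e)\subseteq\mathcal P(E)$ of possible dependency sets, such that for every $e$ and every $X\in D(e)$: $e\notin X$, and $X$ is complete, i.e. for every $f\in X$ there is $Y\in D(f)$ with $Y\subseteq X$. The collection $D(e)$ is read as a predicate in disjunctive normal form: $D(e)$ holds at $X\subseteq E$ if some $Y\in D(e)$ satisfies $Y\subseteq X$. The DSC is \emph{irredundant} if no member of any $D(e)$ is properly contained in another member of $D(e)$. On $\mathcal P(E)$ take the least partial order in which $X$ is above $Y$ whenever $Y\subset X$ and for every $e\in X$ some member of $D(e)$ is contained in $Y$. The \emph{reachable dependency poset} $rdp(E,D)$ consists of the sets lying above $\emptyset$ in this order; it is a finite lattice whose joins are unions. Two DSCs \emph{differ by a renaming} if a bijection of their event sets carries the collections $D(e)$ of one to those of the other; they are \emph{equivalent up to renaming} if some bijection of their event sets carries the predicates $D(e)$ of one to predicates logically equivalent to those of the other. \textbf{Theorem.} (1) For every DSC $(E,D)$ the lattice $rdp(E,D)$ is upper semimodular and has no sublattice isomorphic to $M_3$. It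 is non-distributive if and only if it has a cover-preserving sublattice isomorphic to the centered hexagon $S_7$ (the seven-element lattice with bottom $o$, atoms $b,c$, coatoms $p,q,r$ and top $t$, where $b<p$, $b<q$, $c<q$, $c<r$ are the only relations between atoms and coatoms). In particular, if it is not distributive, then it is not modular. (2) There is a map $uds$ from finite nonempty upper semimodular lattices without $M_3$ as a sublattice to irredundant DSCs, sending isomorphic lattices to DSCs that differ by a renaming, such that (a) $rdp(uds(L))\cong L$ for every such lattice $L$; (b) for every DSC $(E,D)$, $uds(rdp(E,D))$ is equivalent to $(E,D)$ up to renaming; and if $(E,D)$ is irredundant, the two differ by a renaming. -/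

import Mathlib

universe u

/-- A pre-dependency structure with choice: a finite set of events, and a map sending each event
to a nonempty collection of possible dependency sets. -/
structure PreDSC : Type (u + 1) where
  Event : Type u
  [finite_event : Finite Event]
  dep : Event → Set (Set Event)
  dep_nonempty : ∀ e, (dep e).Nonempty

attribute [instance] PreDSC.finite_event

namespace PreDSC

/-- The positive predicate in disjunctive normal form that `dep e` denotes, evaluated at `X`:
some possible dependency set of `e` is contained in `X`. -/
def Sat (D : PreDSC.{u}) (e : D.Event) (X : Set D.Event) : Prop :=
  ∃ Y ∈ D.dep e, Y ⊆ X

/-- A complete event set: each of its elements has a possible dependency set inside it. -/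
def IsComplete (D : PreDSC.{u}) (X : Set D.Event) : Prop :=
  ∀ e ∈ X, D.Sat e X

end PreDSC

/-- A dependency structure with choice. -/
structure DSC : Type (u + 1) extends PreDSC.{u} where
  complete : ∀ e, ∀ X ∈ dep e, toPreDSC.IsComplete X
  acyclic : ∀ e, ∀ X ∈ dep e, e ∉ X

namespace DSC

/-- The generating relation of the reachability order (`X` is above `Y`). -/
def Step (D : DSC.{u}) (Y X : Set D.Event) : Prop :=
  Y ⊂ X ∧ ∀ e ∈ X, D.Sat e Y

/-- The least reflexive and transitive relation containing `Step`. -/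
def ReachLE (D : DSC.{u}) : Set D.Event → Set D.Event → Prop :=
  Relation.ReflTransGen D.Step

/-- The reachable event sets: those lying above the empty event set. -/
def Reachable (D : DSC.{u}) (X : Set D.Event) : Prop :=
  D.ReachLE ∅ X

/-- The reachable dependency poset of `D` (its underlying type). -/
def Rdp (D : DSC.{u}) : Type u :=
  {X : Set D.Event // D.Reachable X}

theorem ReachLE.subset {D : DSC.{u}} {X Y : Set D.Event} (h : D.ReachLE X Y) : X ⊆ Y := by
  induction h with
  | refl => exact subset_rfl
  | tail _ h ih => exact ih.trans h.1.subset

theorem Reachable.isComplete {D : DSC.{u}} {X : Set D.Event} (h : D.Reachable X) :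
    D.IsComplete X := by
  rcases Relation.ReflTransGen.cases_tail h with h | ⟨Y, _, h⟩
  · subst h
    intro e he
    exact he.elim
  · intro e he
    obtain ⟨Z, hZ, hZY⟩ := h.2 e he
    exact ⟨Z, hZ, hZY.trans h.1.subset⟩

theorem reachLE_union {D : DSC.{u}} {X Y : Set D.Event} (hX : D.IsComplete X)
    (hY : D.Reachable Y) : D.ReachLE X (X ∪ Y) := by
  induction hY with
  | refl => rw [Set.union_empty]; exact Relation.ReflTransGen.refl
  | @tail Y Z _ h ih =>
    by_cases hEq : X ∪ Y = X ∪ Z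
    · rw [← hEq]; exact ih
    · refine Relation.ReflTransGen.tail ih
        ⟨(Set.union_subset_union_right X h.1.subset).ssubset_of_ne hEq, ?_⟩
      rintro e (he | he)
      · obtain ⟨W, hW, hWX⟩ := hX e he
        exact ⟨W, hW, hWX.trans Set.subset_union_left⟩
      · obtain ⟨W, hW, hWY⟩ := h.2 e he
        exact ⟨W, hW, hWY.trans Set.subset_union_right⟩

theorem Reachable.union {D : DSC.{u}} {X Y : Set D.Event} (hX : D.Reachable X)
    (hY : D.Reachable Y) : D.Reachable (X ∪ Y) :=
  Relation.ReflTransGen.trans hX (reachLE_union hX.isComplete hY)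

theorem reachLE_iff_subset {D : DSC.{u}} {X Y : Set D.Event} (hX : D.Reachable X)
    (hY : D.Reachable Y) : D.ReachLE X Y ↔ X ⊆ Y := by
  refine ⟨ReachLE.subset, fun h => ?_⟩
  have := reachLE_union hX.isComplete hY
  rwa [Set.union_eq_self_of_subset_left h] at this

theorem reachable_sUnion {D : DSC.{u}} (S : Set (Set D.Event))
    (hS : ∀ X ∈ S, D.Reachable X) : D.Reachable (⋃₀ S) := by
  induction S, S.toFinite using Set.Finite.induction_on with
  | empty => rw [Set.sUnion_empty]; exact Relation.ReflTransGen.refl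
  | @insert X S _ _ ih =>
    rw [Set.sUnion_insert]
    exact (hS X (Set.mem_insert X S)).union
      (ih fun Y hY => hS Y (Set.mem_insert_of_mem X hY))

/-- The reachability order on the reachable event sets. -/
instance instPartialOrderRdp (D : DSC.{u}) : PartialOrder D.Rdp where
  le X Y := D.ReachLE X.1 Y.1
  le_refl _ := Relation.ReflTransGen.refl
  le_trans _ _ _ h h' := Relation.ReflTransGen.trans h h'
  le_antisymm _ _ h h' := Subtype.ext (Set.Subset.antisymm h.subset h'.subset)

theorem rdp_le_iff {D : DSC.{u}} {X Y : D.Rdp} : X ≤ Y ↔ X.1 ⊆ Y.1 :=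
  reachLE_iff_subset X.2 Y.2

/-- The reachability order is a lattice order: joins are unions, and the meet of two reachable
sets is the union of all reachable subsets of their intersection. -/
instance instLatticeRdp (D : DSC.{u}) : Lattice D.Rdp where
  __ := instPartialOrderRdp D
  sup X Y := ⟨X.1 ∪ Y.1, X.2.union Y.2⟩
  le_sup_left _ _ := rdp_le_iff.2 Set.subset_union_left
  le_sup_right _ _ := rdp_le_iff.2 Set.subset_union_right
  sup_le _ _ _ h h' := rdp_le_iff.2 (Set.union_subset (rdp_le_iff.1 h) (rdp_le_iff.1 h'))
  inf X Y := ⟨⋃₀ {Z | D.Reachable Z ∧ Z ⊆ X.1 ∩ Y.1}, reachable_sUnion _ fun _ h => h.1⟩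
  inf_le_left _ _ := rdp_le_iff.2 (Set.sUnion_subset fun _ h => h.2.trans Set.inter_subset_left)
  inf_le_right _ _ := rdp_le_iff.2 (Set.sUnion_subset fun _ h => h.2.trans Set.inter_subset_right)
  le_inf X _ _ h h' := rdp_le_iff.2 (Set.subset_sUnion_of_mem
    ⟨X.2, Set.subset_inter (rdp_le_iff.1 h) (rdp_le_iff.1 h')⟩)

instance instFiniteRdp (D : DSC.{u}) : Finite D.Rdp :=
  inferInstanceAs (Finite {X : Set D.Event // D.Reachable X})

instance instNonemptyRdp (D : DSC.{u}) : Nonempty D.Rdp :=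
  ⟨⟨∅, Relation.ReflTransGen.refl⟩⟩

/-- No possible dependency set of an event contains another one of the same event. -/
def Irredundant (D : DSC.{u}) : Prop :=
  ∀ e, IsAntichain (· ⊆ ·) (D.dep e)

/-- `D'` is obtained from `D` by renaming events. -/
def IsRenaming (D D' : DSC.{u}) : Prop :=
  ∃ σ : D.Event ≃ D'.Event, ∀ e, D'.dep (σ e) = (fun X => σ '' X) '' D.dep e

/-- `D` and `D'` are equivalent up to renaming: some renaming of events turns the dependency
predicates of `D` into predicates logically equivalent to those of `D'`. -/
def EquivUpToRenaming (D D' : DSC.{u}) : Prop :=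
  ∃ σ : D.Event ≃ D'.Event, ∀ e X, D.Sat e X ↔ D'.Sat (σ e) (σ '' X)

end DSC

/-- `L` has a sublattice isomorphic to `M₃`, with bottom `o`, top `t` and middle elements
`a`, `b`, `c`. -/
def HasM3Sublattice (L : Type u) [Lattice L] : Prop :=
  ∃ o a b c t : L, a ≠ b ∧ a ≠ c ∧ b ≠ c ∧
    a ⊓ b = o ∧ a ⊓ c = o ∧ b ⊓ c = o ∧ a ⊔ b = t ∧ a ⊔ c = t ∧ b ⊔ c = t

/-- `L` has a cover-preserving sublattice isomorphic to the centered hexagon `S₇`: bottom `o`,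
atoms `b`, `c`, coatoms `p`, `q`, `r`, top `t`, with `b < p`, `b < q`, `c < q`, `c < r`. -/
def HasCoverPreservingS7 (L : Type u) [Lattice L] : Prop :=
  ∃ o b c p q r t : L,
    o ⋖ b ∧ o ⋖ c ∧ b ⋖ p ∧ b ⋖ q ∧ c ⋖ q ∧ c ⋖ r ∧ p ⋖ t ∧ q ⋖ t ∧ r ⋖ t ∧
    b ⊓ c = o ∧ b ⊓ r = o ∧ c ⊓ p = o ∧ p ⊓ q = b ∧ q ⊓ r = c ∧ p ⊓ r = o ∧
    b ⊔ c = q ∧ b ⊔ r = t ∧ c ⊔ p = t ∧ p ⊔ q = t ∧ q ⊔ r = t ∧ p ⊔ r = t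

/-- Distributivity: joins distribute over meets. -/
def IsDistributiveLattice (L : Type u) [Lattice L] : Prop :=
  ∀ x y z : L, x ⊔ (y ⊓ z) = (x ⊔ y) ⊓ (x ⊔ z)

/-- Upper semimodular lattices without `M₃` as a sublattice. -/
structure IsSemimodularM3Free (L : Type u) [Lattice L] : Prop where
  upperSemimodular : IsUpperModularLattice L
  m3_free : ¬ HasM3Sublattice L

/-! ### Complete sets, reachability and covers in `rdp`. -/

namespace DSC

variable {D : DSC.{u}} {X Y : Set D.Event} {e : D.Event}

/-! Reachable sets are exactly the complete sets, so `rdp` is ordered by inclusion, joins are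
unions, and a cover adds one event. Semimodularity and the absence of M₃ follow by tracking that
event. If distributivity fails, some intersection of complete sets is incomplete, which gives a
fork: an event `z` enabled by two complete sets but not by their common part. Choosing the base
maximal, then the sides minimal, forces the sides to be `o ∪ {x}` and `o ∪ {y}`; then `o`, `x`, `y`,
`z` span S₇.

Conversely, the events of a lattice are its meet-irreducible elements. By
`exists_infIrred_le_not_le` and `IsSemimodularM3Free.eq_of_infIrred` each cover is separated by
exactly one of them, so sending `x` to the meet-irreducibles not above it identifies the lattice
with the complete sets of `latticeDSC`. In any DSC the meet-irreducibles of `rdp` are the elements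
`avoid e`. Hence the order recovers the events and the complete sets, and these recover the
predicates by `sat_iff_exists_isComplete_insert`. -/

theorem Sat.mono (h : D.Sat e X) (hXY : X ⊆ Y) : D.Sat e Y :=
  let ⟨Z, hZ, hZX⟩ := h
  ⟨Z, hZ, hZX.trans hXY⟩

theorem isComplete_sUnion {S : Set (Set D.Event)} (hS : ∀ X ∈ S, D.IsComplete X) :
    D.IsComplete (⋃₀ S) := by
  rintro e ⟨X, hX, he⟩
  exact Sat.mono (hS X hX e he) (Set.subset_sUnion_of_mem hX)

theorem isComplete_union (hX : D.IsComplete X) (hY : D.IsComplete Y) :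
    D.IsComplete (X ∪ Y) := by
  rintro e (he | he)
  · exact Sat.mono (hX e he) Set.subset_union_left
  · exact Sat.mono (hY e he) Set.subset_union_right

theorem isComplete_univ : D.IsComplete Set.univ := fun e _ =>
  let ⟨Y, hY⟩ := D.dep_nonempty e
  ⟨Y, hY, Set.subset_univ Y⟩

/-- A dependency set of `e` inside `X` omits `e`, so it is a properly smaller complete set. The
union of all such sets is reachable by induction, and it is either `X` or one step below `X`. -/
theorem reachable_of_isComplete (hX : D.IsComplete X) : D.Reachable X := by
  induction X using WellFoundedLT.induction with
  | ind X ih =>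
    have hZ : D.Reachable (⋃₀ {Z | D.IsComplete Z ∧ Z ⊂ X}) :=
      reachable_sUnion _ fun Z hZ => ih Z hZ.2 hZ.1
    have hZX : ⋃₀ {Z | D.IsComplete Z ∧ Z ⊂ X} ⊆ X := Set.sUnion_subset fun Z hZ => hZ.2.subset
    rcases hZX.eq_or_ssubset with h | h
    · rwa [h] at hZ
    · refine Relation.ReflTransGen.tail hZ ⟨h, fun e he => ?_⟩
      obtain ⟨Y, hY, hYX⟩ := hX e he
      exact ⟨Y, hY, Set.subset_sUnion_of_mem
        ⟨D.complete e Y hY, hYX.ssubset_of_mem_notMem he (D.acyclic e Y hY)⟩⟩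

theorem isComplete_insert_iff (hX : D.IsComplete X) :
    D.IsComplete (insert e X) ↔ D.Sat e X := by
  constructor
  · intro h
    obtain ⟨Y, hY, hYX⟩ := h e (Set.mem_insert e X)
    exact ⟨Y, hY, (Set.subset_insert_iff_of_notMem (D.acyclic e Y hY)).1 hYX⟩
  · rintro h f (rfl | hf)
    · exact Sat.mono h (Set.subset_insert _ _)
    · exact Sat.mono (hX f hf) (Set.subset_insert _ _)

/-- The family of complete sets alone determines every dependency predicate. -/
theorem sat_iff_exists_isComplete_insert :
    D.Sat e X ↔ ∃ Z ⊆ X, D.IsComplete Z ∧ e ∉ Z ∧ D.IsComplete (insert e Z) := by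
  constructor
  · rintro ⟨Z, hZ, hZX⟩
    have hc := D.complete e Z hZ
    exact ⟨Z, hZX, hc, D.acyclic e Z hZ, (isComplete_insert_iff hc).2 ⟨Z, hZ, subset_rfl⟩⟩
  · rintro ⟨Z, hZX, hc, -, hi⟩
    exact Sat.mono ((isComplete_insert_iff hc).1 hi) hZX

/-- A complete set can be enlarged, one event at a time, to any larger complete set. -/
theorem exists_isComplete_insert (hX : D.IsComplete X) (hY : D.IsComplete Y) (h : X ⊂ Y) :
    ∃ e ∈ Y, e ∉ X ∧ D.IsComplete (insert e X) := by
  have hr := (reachLE_iff_subset (reachable_of_isComplete hX) (reachable_of_isComplete hY)).2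
    h.subset
  rcases Relation.ReflTransGen.cases_head hr with rfl | ⟨Z, hXZ, hZY⟩
  · exact (h.ne rfl).elim
  · obtain ⟨e, heZ, heX⟩ := Set.exists_of_ssubset hXZ.1
    exact ⟨e, ReachLE.subset hZY heZ, heX, (isComplete_insert_iff hX).2 (hXZ.2 e heZ)⟩

/-- The largest complete subset of a set. -/
def core (D : DSC.{u}) (X : Set D.Event) : Set D.Event :=
  ⋃₀ {Z | D.IsComplete Z ∧ Z ⊆ X}

theorem isComplete_core : D.IsComplete (D.core X) := isComplete_sUnion fun _ h => h.1

theorem core_subset : D.core X ⊆ X := Set.sUnion_subset fun _ h => h.2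

theorem subset_core (hY : D.IsComplete Y) (h : Y ⊆ X) : Y ⊆ D.core X :=
  Set.subset_sUnion_of_mem ⟨hY, h⟩

/-- A complete set of events, as an element of the reachable dependency poset. -/
def mkRdp (X : Set D.Event) (hX : D.IsComplete X) : D.Rdp :=
  ⟨X, reachable_of_isComplete hX⟩

theorem rdp_isComplete (A : D.Rdp) : D.IsComplete A.1 := Reachable.isComplete A.2

theorem rdp_lt_iff {A B : D.Rdp} : A < B ↔ A.1 ⊂ B.1 := by
  rw [lt_iff_le_not_ge, rdp_le_iff, rdp_le_iff]
  rfl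

theorem rdp_covBy_of_eq_insert {A B : D.Rdp} (he : e ∉ A.1) (h : B.1 = insert e A.1) :
    A ⋖ B := by
  refine ⟨rdp_lt_iff.2 (h ▸ Set.ssubset_insert he), fun C hAC hCB => ?_⟩
  rw [rdp_lt_iff] at hAC hCB
  obtain ⟨f, hfC, hfA⟩ := Set.exists_of_ssubset hAC
  have hfe : f = e := (h ▸ hCB.subset hfC : f ∈ insert e A.1).resolve_right hfA
  refine hCB.2 ?_
  rw [h]
  exact Set.insert_subset (hfe ▸ hfC) hAC.subset

theorem rdp_eq_insert_of_covBy {A B : D.Rdp} (h : A ⋖ B) :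
    ∃ e ∉ A.1, B.1 = insert e A.1 := by
  obtain ⟨e, heB, heA, hc⟩ :=
    exists_isComplete_insert (rdp_isComplete A) (rdp_isComplete B) (rdp_lt_iff.1 h.lt)
  refine ⟨e, heA, ?_⟩
  have h1 : A < mkRdp _ hc := rdp_lt_iff.2 (Set.ssubset_insert heA)
  have h2 : mkRdp _ hc ≤ B :=
    rdp_le_iff.2 (Set.insert_subset heB (rdp_lt_iff.1 h.lt).subset)
  exact congrArg Subtype.val ((h.eq_or_eq h1.le h2).resolve_left h1.ne').symm

/-! ### Semimodularity, absence of M₃, and forks. -/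

theorem isUpperModularLattice_rdp (D : DSC.{u}) : IsUpperModularLattice D.Rdp where
  covBy_sup_of_inf_covBy {A B} h := by
    obtain ⟨e, he, hA⟩ := rdp_eq_insert_of_covBy h
    have hB : (A ⊓ B).1 ⊆ B.1 := rdp_le_iff.1 inf_le_right
    have heB : e ∉ B.1 := fun heB => by
      refine h.lt.ne (inf_eq_left.2 (rdp_le_iff.2 ?_))
      rw [hA]
      exact Set.insert_subset heB hB
    refine rdp_covBy_of_eq_insert heB ?_
    change A.1 ∪ B.1 = _
    rw [hA, Set.insert_union, Set.union_eq_self_of_subset_left hB]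

/-- An event of `a` that can be added to `o` lies in the union of `b` and `c`, hence in one of them,
and so in a meet that should be `o`. -/
theorem not_hasM3Sublattice_rdp (D : DSC.{u}) : ¬ HasM3Sublattice D.Rdp := by
  rintro ⟨o, a, b, c, t, -, -, hbc, hab, hac, -, hab', hac', hbc'⟩
  have hoa : o < a := by
    refine lt_of_le_of_ne (hab ▸ inf_le_left) fun h => hbc ?_
    subst h
    rw [inf_eq_left] at hab hac
    rw [sup_eq_right.2 hab] at hab'
    rw [sup_eq_right.2 hac] at hac'
    exact hab'.trans hac'.symm
  obtain ⟨e, hea, heo, hc⟩ :=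
    exists_isComplete_insert (rdp_isComplete o) (rdp_isComplete a) (rdp_lt_iff.1 hoa)
  have key : ∀ d : D.Rdp, a ⊓ d = o → e ∉ d.1 := fun d hd hed => by
    have hle : mkRdp _ hc ≤ a ⊓ d := le_inf
      (rdp_le_iff.2 (Set.insert_subset hea (rdp_lt_iff.1 hoa).subset))
      (rdp_le_iff.2 (Set.insert_subset hed (rdp_le_iff.1 (hd ▸ inf_le_right))))
    rw [hd, rdp_le_iff] at hle
    exact heo (hle (Set.mem_insert e o.1))
  have het : e ∈ b.1 ∪ c.1 := by
    have : a ≤ b ⊔ c := by rw [hbc', ← hab']; exact le_sup_left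
    exact rdp_le_iff.1 this hea
  exact het.elim (key b hab) (key c hac)

theorem isDistributiveLattice_rdp
    (h : ∀ A B : Set D.Event, D.IsComplete A → D.IsComplete B → D.IsComplete (A ∩ B)) :
    IsDistributiveLattice D.Rdp := by
  have hinf : ∀ A B : D.Rdp, (A ⊓ B).1 = A.1 ∩ B.1 := fun A B =>
    Set.Subset.antisymm
      (Set.subset_inter (rdp_le_iff.1 inf_le_left) (rdp_le_iff.1 inf_le_right))
      (Set.subset_sUnion_of_mem
        ⟨reachable_of_isComplete (h _ _ (rdp_isComplete A) (rdp_isComplete B)), subset_rfl⟩)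
  intro A B C
  refine Subtype.ext ?_
  rw [hinf]
  change A.1 ∪ (B ⊓ C).1 = (A.1 ∪ B.1) ∩ (A.1 ∪ C.1)
  rw [hinf, Set.union_inter_distrib_left]

/-- Complete sets `A` and `B` that both enable the event `z`, which the largest complete subset
`o` of their intersection does not enable. -/
structure IsFork (o A B : Set D.Event) (z : D.Event) : Prop where
  isComplete_base : D.IsComplete o
  isComplete_left : D.IsComplete A
  isComplete_right : D.IsComplete B
  isComplete_insert_left : D.IsComplete (insert z A)
  isComplete_insert_right : D.IsComplete (insert z B)
  notMem_left : z ∉ A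
  notMem_right : z ∉ B
  subset_left : o ⊆ A
  subset_right : o ⊆ B
  le_base : ∀ F, D.IsComplete F → F ⊆ A → F ⊆ B → F ⊆ o
  not_isComplete_insert_base : ¬ D.IsComplete (insert z o)

theorem IsFork.symm {o A B : Set D.Event} {z : D.Event} (h : IsFork o A B z) :
    IsFork o B A z where
  isComplete_base := h.isComplete_base
  isComplete_left := h.isComplete_right
  isComplete_right := h.isComplete_left
  isComplete_insert_left := h.isComplete_insert_right
  isComplete_insert_right := h.isComplete_insert_left
  notMem_left := h.notMem_right
  notMem_right := h.notMem_left
  subset_left := h.subset_right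
  subset_right := h.subset_left
  le_base F hF h1 h2 := h.le_base F hF h2 h1
  not_isComplete_insert_base := h.not_isComplete_insert_base

theorem exists_isFork {A B : Set D.Event} (hA : D.IsComplete A) (hB : D.IsComplete B)
    (h : ¬ D.IsComplete (A ∩ B)) : ∃ (o A B : Set D.Event) (z : D.Event), IsFork o A B z := by
  simp only [PreDSC.IsComplete, not_forall] at h
  obtain ⟨z, hz, hn⟩ := h
  obtain ⟨A', hA', hcA, hzA, hiA⟩ := sat_iff_exists_isComplete_insert.1 (hA z hz.1)
  obtain ⟨B', hB', hcB, hzB, hiB⟩ := sat_iff_exists_isComplete_insert.1 (hB z hz.2)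
  refine ⟨D.core (A' ∩ B'), A', B', z, isComplete_core, hcA, hcB, hiA, hiB, hzA, hzB,
    core_subset.trans Set.inter_subset_left, core_subset.trans Set.inter_subset_right,
    fun F hF h1 h2 => subset_core hF (Set.subset_inter h1 h2), fun hc => hn ?_⟩
  exact Sat.mono ((isComplete_insert_iff isComplete_core).1 hc)
    (core_subset.trans (Set.inter_subset_inter hA' hB'))

/-- A fork that cannot be improved, by enlarging its base or by shrinking its sides over the same
base, has sides that exceed the base by one event. -/
theorem IsFork.exists_left_eq_insert {o A B : Set D.Event} {z : D.Event} (h : IsFork o A B z)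
    (hbase : ∀ (o' A' B' : Set D.Event) (z' : D.Event), o ⊂ o' → ¬ IsFork o' A' B' z')
    (hside : ∀ (A' B' : Set D.Event) (z' : D.Event), A' ⊂ A → B' ⊆ B → ¬ IsFork o A' B' z') :
    ∃ x ∉ o, A = insert x o := by
  have hoA : o ⊂ A := h.subset_left.ssubset_of_ne fun hEq =>
    h.not_isComplete_insert_base (hEq ▸ h.isComplete_insert_left)
  obtain ⟨x, hxA, hxo, hx⟩ := exists_isComplete_insert h.isComplete_base h.isComplete_left hoA
  refine ⟨x, hxo, ?_⟩
  by_contra hne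
  have hxsub : insert x o ⊆ A := Set.insert_subset hxA h.subset_left
  have hoxA : insert x o ⊂ A := hxsub.ssubset_of_ne (Ne.symm hne)
  have hxB : insert x o ∪ B = insert x B := by
    rw [Set.insert_union, Set.union_eq_self_of_subset_left h.subset_right]
  have hBx : D.IsComplete (insert x B) := hxB ▸ isComplete_union hx h.isComplete_right
  have hBxz : D.IsComplete (insert z (insert x B)) := by
    have := isComplete_union hx h.isComplete_insert_right
    rwa [Set.union_insert, hxB] at this
  have hxC : insert x o ⊆ D.core (A ∩ insert x B) :=
    subset_core hx (Set.subset_inter hxsub (Set.insert_subset_insert h.subset_right))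
  have hCA : D.core (A ∩ insert x B) ⊆ A := core_subset.trans Set.inter_subset_left
  have hoC : o ⊆ D.core (A ∩ insert x B) := (Set.subset_insert x o).trans hxC
  -- Otherwise this core, which contains `x`, is the base of a fork with sides `A` and `insert x B`,
  -- against the maximality of `o`.
  have hzC : D.IsComplete (insert z (D.core (A ∩ insert x B))) := by
    by_contra hn
    refine hbase _ A (insert x B) z ((Set.ssubset_insert hxo).trans_subset hxC)
      ⟨isComplete_core, h.isComplete_left, hBx, h.isComplete_insert_left, hBxz, h.notMem_left,
        ?_, hCA, core_subset.trans Set.inter_subset_right,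
        fun F hF h1 h2 => subset_core hF (Set.subset_inter h1 h2), hn⟩
    rintro (rfl | hz)
    exacts [h.notMem_left hxA, h.notMem_right hz]
  -- Since the core enables `z`, it could replace `A` over the base `o` if it were smaller.
  have hEq : D.core (A ∩ insert x B) = A := by
    by_contra hn
    exact hside _ B z (hCA.ssubset_of_ne hn) subset_rfl
      ⟨h.isComplete_base, isComplete_core, h.isComplete_right, hzC, h.isComplete_insert_right,
        fun hz => h.notMem_left (hCA hz), h.notMem_right, hoC, h.subset_right,
        fun F hF h1 h2 => h.le_base F hF (h1.trans hCA) h2, h.not_isComplete_insert_base⟩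
  have hAB : A ⊆ insert x B := by
    rw [← hEq]
    exact core_subset.trans Set.inter_subset_right
  -- The next event `w` of `A` also lies in `B`. It is enabled by `insert x o` and by the largest
  -- complete part of `B` avoiding `w`, which gives a fork over `o` with smaller sides.
  obtain ⟨w, hwA, hwo, hw⟩ := exists_isComplete_insert hx h.isComplete_left hoxA
  rw [Set.mem_insert_iff, not_or] at hwo
  have hwB : w ∈ B := (hAB hwA).resolve_left hwo.1
  have hoB : o ⊆ D.core (B \ {w}) := subset_core h.isComplete_base
    (Set.subset_sdiff_singleton h.subset_right hwo.2)
  have hCB : D.core (B \ {w}) ⊆ B := core_subset.trans Set.sdiff_subset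
  have hwC : w ∉ D.core (B \ {w}) := fun hw' => (core_subset hw').2 rfl
  obtain ⟨v, hvB, hvC, hv⟩ := exists_isComplete_insert isComplete_core h.isComplete_right
    (hCB.ssubset_of_mem_notMem hwB hwC)
  have hvw : v = w := by
    by_contra hvw
    have hsub : insert v (D.core (B \ {w})) ⊆ B \ {w} := Set.insert_subset ⟨hvB, hvw⟩ core_subset
    exact hvC (subset_core hv hsub (Set.mem_insert _ _))
  subst hvw
  refine hside _ _ v hoxA hCB ⟨h.isComplete_base, hx, isComplete_core, hw, hv, ?_, hwC,
    Set.subset_insert x o, hoB, fun F hF h1 h2 => h.le_base F hF (h1.trans hxsub) (h2.trans hCB),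
    fun hc => hwo.2 ?_⟩
  · rintro (hvx | hvo)
    exacts [hwo.1 hvx, hwo.2 hvo]
  · exact h.le_base _ hc (Set.insert_subset hwA h.subset_left)
      (Set.insert_subset hwB h.subset_right) (Set.mem_insert _ _)

theorem exists_isFork_insert (h : ∃ (o A B : Set D.Event) (z : D.Event), IsFork o A B z) :
    ∃ (o : Set D.Event) (x y z : D.Event), x ∉ o ∧ y ∉ o ∧
      IsFork o (insert x o) (insert y o) z := by
  obtain ⟨o, ⟨A₀, B₀, z₀, h₀⟩, homax⟩ := WellFounded.has_min
    (wellFounded_gt : WellFounded ((· > ·) : Set D.Event → Set D.Event → Prop))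
    {o | ∃ (A B : Set D.Event) (z : D.Event), IsFork o A B z} h
  obtain ⟨⟨A, B⟩, ⟨z, hf⟩, hmin⟩ := WellFounded.has_min
    (wellFounded_lt : WellFounded
      ((· < ·) : Set D.Event × Set D.Event → Set D.Event × Set D.Event → Prop))
    {p | ∃ z : D.Event, IsFork o p.1 p.2 z} ⟨(A₀, B₀), z₀, h₀⟩
  have hbase : ∀ (o' A' B' : Set D.Event) (z' : D.Event), o ⊂ o' → ¬ IsFork o' A' B' z' :=
    fun o' A' B' z' ho' hf' => homax o' ⟨A', B', z', hf'⟩ ho'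
  obtain ⟨x, hx, rfl⟩ := hf.exists_left_eq_insert hbase fun A' B' z' hA hB hf' =>
    hmin (A', B') ⟨z', hf'⟩ (Prod.mk_lt_mk.2 (Or.inl ⟨hA, hB⟩))
  obtain ⟨y, hy, rfl⟩ := hf.symm.exists_left_eq_insert hbase fun B' A' z' hB hA hf' =>
    hmin (A', B') ⟨z', hf'.symm⟩ (Prod.mk_lt_mk.2 (Or.inr ⟨hA, hB⟩))
  exact ⟨o, x, y, z, hx, hy, hf⟩

end DSC

theorem CovBy.inf_eq_of_not_le {L : Type*} [Lattice L] {a b c : L} (h : a ⋖ b) (hac : a ≤ c)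
    (hbc : ¬ b ≤ c) : b ⊓ c = a :=
  (h.eq_or_eq (le_inf h.le hac) inf_le_left).resolve_right fun h => hbc (inf_eq_left.1 h)

/-! ### The centered hexagon. -/

namespace DSC

variable {D : DSC.{u}} {X Y : Set D.Event} {e : D.Event}

theorem hasCoverPreservingS7_rdp (h : ¬ IsDistributiveLattice D.Rdp) :
    HasCoverPreservingS7 D.Rdp := by
  have h' : ∃ (o A B : Set D.Event) (z : D.Event), IsFork o A B z := by
    by_contra hn
    refine h (isDistributiveLattice_rdp fun A B hA hB => ?_)
    by_contra hAB
    exact hn (exists_isFork hA hB hAB)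
  obtain ⟨o, x, y, z, hxo, hyo, hf⟩ := exists_isFork_insert h'
  have hxz : x ≠ z := fun hxz => hf.notMem_left (hxz ▸ Set.mem_insert _ _)
  have hyz : y ≠ z := fun hyz => hf.notMem_right (hyz ▸ Set.mem_insert _ _)
  have hxy : x ≠ y := by
    rintro rfl
    exact hxo (hf.le_base _ hf.isComplete_left subset_rfl subset_rfl (Set.mem_insert _ _))
  have hzo : z ∉ o := fun hz => hf.notMem_left (Or.inr hz)
  have hq := isComplete_union hf.isComplete_left hf.isComplete_right
  have ht := isComplete_union hf.isComplete_insert_left hf.isComplete_insert_right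
  let o' := mkRdp o hf.isComplete_base
  let b := mkRdp _ hf.isComplete_left
  let c := mkRdp _ hf.isComplete_right
  let p := mkRdp _ hf.isComplete_insert_left
  let r := mkRdp _ hf.isComplete_insert_right
  let q := mkRdp _ hq
  let t := mkRdp _ ht
  have hob : o' ⋖ b := rdp_covBy_of_eq_insert hxo rfl
  have hoc : o' ⋖ c := rdp_covBy_of_eq_insert hyo rfl
  have hbp : b ⋖ p := rdp_covBy_of_eq_insert hf.notMem_left rfl
  have hcr : c ⋖ r := rdp_covBy_of_eq_insert hf.notMem_right rfl
  have hbq : b ⋖ q := rdp_covBy_of_eq_insert (e := y)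
    (by simp [b, mkRdp, hxy.symm, hyo]) (by ext w; simp [b, q, mkRdp])
  have hcq : c ⋖ q := rdp_covBy_of_eq_insert (e := x)
    (by simp [c, mkRdp, hxy, hxo]) (by ext w; simp [c, q, mkRdp]; tauto)
  have hpt : p ⋖ t := rdp_covBy_of_eq_insert (e := y)
    (by simp [p, mkRdp, hxy.symm, hyo, hyz]) (by ext w; simp [p, t, mkRdp]; tauto)
  have hqt : q ⋖ t := rdp_covBy_of_eq_insert (e := z)
    (by simp [q, mkRdp, hxz.symm, hzo, hyz.symm]) (by ext w; simp [q, t, mkRdp]; tauto)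
  have hrt : r ⋖ t := rdp_covBy_of_eq_insert (e := x)
    (by simp [r, mkRdp, hxy, hxo, hxz]) (by ext w; simp [r, t, mkRdp]; tauto)
  have hbr : ¬ b ≤ r := fun hle => by
    simpa [r, mkRdp, hxy, hxz, hxo] using rdp_le_iff.1 hle (Set.mem_insert x o)
  have hcp : ¬ c ≤ p := fun hle => by
    simpa [p, mkRdp, hxy.symm, hyz, hyo] using rdp_le_iff.1 hle (Set.mem_insert y o)
  have hor : o' ≤ r := hoc.le.trans hcr.le
  have hop : o' ≤ p := hob.le.trans hbp.le
  refine ⟨o', b, c, p, q, r, t, hob, hoc, hbp, hbq, hcq, hcr, hpt, hqt, hrt,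
    hob.inf_eq_of_not_le hoc.le fun h => hbr (h.trans hcr.le),
    hob.inf_eq_of_not_le hor hbr, hoc.inf_eq_of_not_le hop hcp, ?_, ?_, ?_, ?_, ?_, ?_, ?_, ?_, ?_⟩
  · rw [inf_comm]
    exact hbq.inf_eq_of_not_le hbp.le fun h => hcp (hcq.le.trans h)
  · exact hcq.inf_eq_of_not_le hcr.le fun h => hbr (hbq.le.trans h)
  -- Only `z` could be an extra event of `p ⊓ r`, but `insert z o` is not complete.
  · refine le_antisymm ?_ (le_inf hop hor)
    rw [rdp_le_iff]
    have hF := isComplete_union (rdp_isComplete (p ⊓ r)) hf.isComplete_base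
    have hFp : (p ⊓ r).1 ⊆ insert z (insert x o) := rdp_le_iff.1 inf_le_left
    have hFr : (p ⊓ r).1 ⊆ insert z (insert y o) := rdp_le_iff.1 inf_le_right
    have hFz : (p ⊓ r).1 ⊆ insert z o := fun w hw => by
      rcases hFp hw with h | rfl | h
      · exact Or.inl h
      · simpa [hxz, hxy, hxo] using hFr hw
      · exact Or.inr h
    by_cases hz : z ∈ (p ⊓ r).1
    · refine (hf.not_isComplete_insert_base ?_).elim
      rwa [(Set.union_subset hFz (Set.subset_insert _ _)).antisymm
        (Set.insert_subset (Or.inl hz) Set.subset_union_right)] at hF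
    · exact (Set.subset_insert_iff_of_notMem hz).1 hFz
  · rfl
  · exact Subtype.ext (show insert x o ∪ insert z (insert y o) =
      insert z (insert x o) ∪ insert z (insert y o) by ext w; simp; tauto)
  · exact Subtype.ext (show insert y o ∪ insert z (insert x o) =
      insert z (insert x o) ∪ insert z (insert y o) by ext w; simp; tauto)
  · exact Subtype.ext (show insert z (insert x o) ∪ (insert x o ∪ insert y o) =
      insert z (insert x o) ∪ insert z (insert y o) by ext w; simp; tauto)
  · exact Subtype.ext (show (insert x o ∪ insert y o) ∪ insert z (insert y o) =
      insert z (insert x o) ∪ insert z (insert y o) by ext w; simp; tauto)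
  · rfl

end DSC

/-- The elements `b < p` have the same meet and the same join with `r`, a pentagon. -/
theorem HasCoverPreservingS7.not_isModularLattice {L : Type u} [Lattice L]
    (h : HasCoverPreservingS7 L) : ¬ IsModularLattice L := by
  obtain ⟨o, b, c, p, q, r, t, -, -, hbp, -, -, -, -, -, -, -, hbr', -, -, -, hpr, -, hbr, -, -,
    -, hpr'⟩ := h
  intro _
  refine hbp.ne (eq_of_le_of_inf_le_of_sup_le (z := r) hbp.le ?_ (hpr'.trans hbr.symm).le)
  rw [hpr, hbr']

theorem HasCoverPreservingS7.not_isDistributiveLattice {L : Type u} [Lattice L]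
    (h : HasCoverPreservingS7 L) : ¬ IsDistributiveLattice L := by
  obtain ⟨o, b, c, p, q, r, t, hob, -, hbp, -, -, -, hpt, -, -, -, -, -, -, -, hpr, -, hbr, -⟩ := h
  intro hd
  have := hd b p r
  rw [hpr, hbr, sup_eq_left.2 hob.le, sup_eq_right.2 hbp.le, inf_eq_left.2 hpt.le] at this
  exact hbp.ne this

/-! ### Covers in semimodular M₃-free lattices. -/

namespace IsSemimodularM3Free

variable {L : Type u} [Lattice L]

theorem covBy_sup (hL : IsSemimodularM3Free L) {a b c : L} (h : a ⋖ b) (hac : a ≤ c)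
    (hbc : ¬ b ≤ c) : c ⋖ c ⊔ b := by
  have := hL.upperSemimodular
  rw [sup_comm]
  refine covBy_sup_of_inf_covBy_left ?_
  rwa [h.inf_eq_of_not_le hac hbc]

/-- Joining with `n` is injective on the covers of `o ≤ n` that do not lie below `n`. -/
theorem sup_ne_sup [Finite L] (hL : IsSemimodularM3Free L) {o n a b : L} (hon : o ≤ n)
    (ha : o ⋖ a) (hb : o ⋖ b) (hab : a ≠ b) (han : ¬ a ≤ n) (hbn : ¬ b ≤ n) :
    n ⊔ a ≠ n ⊔ b := by
  induction o using WellFoundedGT.induction generalizing a b with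
  | ind o ih =>
  rcases hon.eq_or_lt with rfl | hon
  · rwa [sup_eq_right.2 ha.le, sup_eq_right.2 hb.le]
  -- Climb towards `n`: passing from `o`, `a`, `b` to `c`, `c ⊔ a`, `c ⊔ b` leaves the joins with
  -- `n` unchanged. Were the new covers equal, `a`, `b`, `c` would form an M₃ over `o`.
  obtain ⟨c, hc, hcn⟩ := exists_covBy_le_of_lt hon
  have hnc : ∀ {d}, o ⋖ d → ¬ d ≤ n → ¬ d ≤ c := fun _ h h' => h (h'.trans hcn)
  have hca : c ≠ a := fun h => han (h ▸ hcn)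
  have hcb : c ≠ b := fun h => hbn (h ▸ hcn)
  have hnle : ∀ {d e}, o ⋖ d → o ⋖ e → d ≠ e → ¬ d ≤ e := fun hd he hne h =>
    (he.eq_or_eq hd.le h).elim hd.ne' hne
  have hsup : ∀ d, n ⊔ (c ⊔ d) = n ⊔ d := fun d => by
    rw [← sup_assoc, sup_eq_left.2 hcn]
  have hne : c ⊔ a ≠ c ⊔ b := by
    intro h
    have hcov : a ⋖ c ⊔ a := sup_comm a c ▸ hL.covBy_sup hc ha.le (hnle hc ha hca)
    have hab' : a ⊔ b = c ⊔ a :=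
      (hcov.eq_or_eq le_sup_left (sup_le le_sup_right (h ▸ le_sup_right))).resolve_left
        fun h' => hnle hb ha hab.symm (sup_eq_left.1 h')
    exact hL.m3_free ⟨o, a, b, c, c ⊔ a, hab, hca.symm, hcb.symm,
      ha.inf_eq_of_not_le hb.le (hnle ha hb hab), ha.inf_eq_of_not_le hc.le (hnc ha han),
      hb.inf_eq_of_not_le hc.le (hnc hb hbn), hab', sup_comm _ _, by rw [h, sup_comm]⟩
  rw [← hsup a, ← hsup b]
  exact ih c hc.lt hcn (hL.covBy_sup ha hc.le (hnc ha han)) (hL.covBy_sup hb hc.le (hnc hb hbn)) hne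
    (fun h => han (le_sup_right.trans h)) fun h => hbn (le_sup_right.trans h)

end IsSemimodularM3Free

/-! ### Meet-irreducible elements and enabling sets. -/

section

variable {L : Type u} [Lattice L]

/-- Take `m` maximal among the elements above `x` and not above `y`: everything strictly above `m`
is above `y`, and so are meets of such elements. -/
theorem exists_infIrred_le_not_le [Finite L] {x y : L} (h : ¬ y ≤ x) :
    ∃ m, InfIrred m ∧ x ≤ m ∧ ¬ y ≤ m := by
  obtain ⟨m, hm⟩ := (Set.toFinite {m | x ≤ m ∧ ¬ y ≤ m}).exists_maximal ⟨x, le_rfl, h⟩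
  refine ⟨m, ⟨fun hmax => hm.prop.2 (le_sup_right.trans (hmax le_sup_left)), ?_⟩, hm.prop⟩
  intro b c hbc
  have key : ∀ d, m ≤ d → d ≠ m → y ≤ d := fun d hd hne => by
    by_contra hyd
    exact hne (hm.eq_of_le ⟨hm.prop.1.trans hd, hyd⟩ hd).symm
  by_contra! hne
  exact hm.prop.2 (hbc ▸ le_inf (key b (hbc ▸ inf_le_left) hne.1)
    (key c (hbc ▸ inf_le_right) hne.2))

theorem InfIrred.eq_of_covBy {m a b : L} (h : InfIrred m) (ha : m ⋖ a) (hb : m ⋖ b) : a = b := by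
  by_contra hne
  have hnle : ¬ a ≤ b := fun h => (hb.eq_or_eq ha.le h).elim ha.ne' hne
  exact (h.2 (ha.inf_eq_of_not_le hb.le hnle)).elim ha.ne' hb.ne'

/-- In a finite semimodular `M₃`-free lattice a covering pair is separated by only one
meet-irreducible element. -/
theorem IsSemimodularM3Free.eq_of_infIrred [Finite L] (hL : IsSemimodularM3Free L)
    {x y m n : L} (hxy : x ⋖ y) (hm : InfIrred m) (hn : InfIrred n) (hxm : x ≤ m) (hym : ¬ y ≤ m)
    (hxn : x ≤ n) (hyn : ¬ y ≤ n) : m = n := by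
  by_contra hne
  have hcm := hL.covBy_sup hxy hxm hym
  have hcn := hL.covBy_sup hxy hxn hyn
  have hmn : ¬ m ≤ n := fun h => by
    obtain ⟨z, hz, hzn⟩ := exists_covBy_le_of_lt (lt_of_le_of_ne h hne)
    exact hyn (le_sup_right.trans ((hm.eq_of_covBy hcm hz).le.trans hzn))
  -- This and `a` below are distinct covers of `m ⊓ n` not below `n`. Their joins with `n` both
  -- equal the unique upper cover of `n`, contradicting `sup_ne_sup`.
  have hz : m ⊓ n ⋖ m ⊓ n ⊔ y :=
    hL.covBy_sup hxy (le_inf hxm hxn) fun h => hym (h.trans inf_le_left)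
  obtain ⟨a, ha, ham⟩ := exists_covBy_le_of_lt
    (lt_of_le_of_ne (inf_le_left : m ⊓ n ≤ m) fun h => hmn (inf_eq_left.1 h))
  have han : ¬ a ≤ n := fun h => ha.lt.not_ge (le_inf ham h)
  have hyn' : ¬ m ⊓ n ⊔ y ≤ n := fun h => hyn (le_sup_right.trans h)
  refine hL.sup_ne_sup inf_le_right ha hz (fun h => hym ?_) han hyn'
    (hn.eq_of_covBy (hL.covBy_sup ha inf_le_right han) (hL.covBy_sup hz inf_le_right hyn'))
  exact (le_sup_right.trans h.ge).trans ham

/-- The meet-irreducible elements of a lattice that are not above a given element. -/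
def infIrredsNotAbove (x : L) : Set {m : L // InfIrred m} :=
  {m | ¬ x ≤ m.1}

theorem infIrredsNotAbove_subset_iff [Finite L] {x y : L} :
    infIrredsNotAbove x ⊆ infIrredsNotAbove y ↔ x ≤ y := by
  refine ⟨fun h => ?_, fun h m hm hy => hm (h.trans hy)⟩
  by_contra hxy
  obtain ⟨m, hm, hym, hxm⟩ := exists_infIrred_le_not_le hxy
  exact h (show (⟨m, hm⟩ : {m : L // InfIrred m}) ∈ infIrredsNotAbove x from hxm) hym

theorem infIrredsNotAbove_sup (x y : L) :
    infIrredsNotAbove (x ⊔ y) = infIrredsNotAbove x ∪ infIrredsNotAbove y := by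
  ext m
  simp only [infIrredsNotAbove, Set.mem_ofPred_eq, Set.mem_union, sup_le_iff]
  tauto

/-- The sets of meet-irreducible elements that enable the meet-irreducible element `m`. -/
def enablingSets (m : {m : L // InfIrred m}) : Set (Set {m : L // InfIrred m}) :=
  {X | ∃ x y : L, x ⋖ y ∧ x ≤ m.1 ∧ ¬ y ≤ m.1 ∧ X = infIrredsNotAbove x}

theorem infIrredsNotAbove_of_covBy [Finite L] (hL : IsSemimodularM3Free L) {x y : L}
    (hxy : x ⋖ y) {m : {m : L // InfIrred m}} (hxm : x ≤ m.1) (hym : ¬ y ≤ m.1) :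
    infIrredsNotAbove y = insert m (infIrredsNotAbove x) := by
  refine Set.Subset.antisymm (fun n hyn => ?_)
    (Set.insert_subset hym (infIrredsNotAbove_subset_iff.2 hxy.le))
  by_cases hxn : x ≤ n.1
  · exact Or.inl (Subtype.ext (hL.eq_of_infIrred hxy n.2 m.2 hxn hyn hxm hym))
  · exact Or.inr hxn

/-- Any cover inside `[w, x]` of a maximal common lower bound `w` of `x` and `m` leaves the elements
below `m`. -/
theorem exists_enablingSet_subset [Finite L] [Nonempty L] {x : L} {m : {m : L // InfIrred m}}
    (hm : m ∈ infIrredsNotAbove x) :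
    ∃ Y, Minimal (· ∈ enablingSets m) Y ∧ Y ⊆ infIrredsNotAbove x := by
  obtain ⟨w, hw⟩ := (Set.toFinite {w | w ≤ x ∧ w ≤ m.1}).exists_maximal
    ⟨x ⊓ m.1, inf_le_left, inf_le_right⟩
  have hwx : w < x := lt_of_le_of_ne hw.prop.1 fun h => hm (h ▸ hw.prop.2)
  obtain ⟨v, hwv, hvx⟩ := exists_covBy_le_of_lt hwx
  have hvm : ¬ v ≤ m.1 := fun h => hwv.ne (hw.eq_of_le ⟨hvx, h⟩ hwv.le)
  obtain ⟨Y, hYw, hY⟩ := (Set.toFinite (enablingSets m)).exists_le_minimal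
    (show infIrredsNotAbove w ∈ enablingSets m from ⟨w, v, hwv, hw.prop.2, hvm, rfl⟩)
  exact ⟨Y, hY, hYw.trans (infIrredsNotAbove_subset_iff.2 hwx.le)⟩

end

/-- The dependency structure of a finite semimodular `M₃`-free lattice: the events are the
meet-irreducible elements, and the dependency sets are the minimal enabling sets. -/
def latticeDSC (L : Type u) [Lattice L] [Finite L] [Nonempty L] : DSC.{u} where
  Event := {m : L // InfIrred m}
  dep m := {X | Minimal (· ∈ enablingSets m) X}
  dep_nonempty m := by
    obtain ⟨y, hy⟩ : ∃ y, ¬ y ≤ m.1 := by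
      by_contra! h
      exact m.2.1 fun y _ => h y
    obtain ⟨Y, hY, -⟩ := exists_enablingSet_subset (x := y) hy
    exact ⟨Y, hY⟩
  complete := by
    rintro m X ⟨⟨x, y, hxy, hxm, hym, rfl⟩, -⟩ n hn
    exact exists_enablingSet_subset hn
  acyclic := by
    rintro m X ⟨⟨x, y, hxy, hxm, hym, rfl⟩, -⟩ hm
    exact hm hxm

/-! ### Complete sets of `latticeDSC`. -/

section

variable {L : Type u} [Lattice L] [Finite L] [Nonempty L]

theorem latticeDSC_irredundant : (latticeDSC L).Irredundant :=
  fun _ => setOfPred_minimal_antichain _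

theorem isComplete_infIrredsNotAbove (x : L) :
    (latticeDSC L).IsComplete (infIrredsNotAbove x) :=
  fun _ hm => exists_enablingSet_subset hm

theorem exists_eq_infIrredsNotAbove (hL : IsSemimodularM3Free L)
    {X : Set (latticeDSC L).Event} (hX : (latticeDSC L).IsComplete X) :
    ∃ x : L, X = infIrredsNotAbove x := by
  obtain ⟨z⟩ := ‹Nonempty L›
  obtain ⟨x, hx⟩ := (Set.toFinite {x : L | infIrredsNotAbove x ⊆ X}).exists_maximal <| by
    -- A minimal element of the lattice is least, so its associated set is empty.
    obtain ⟨w, -, hw⟩ := (Set.toFinite (Set.univ : Set L)).exists_le_minimal (Set.mem_univ z)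
    refine ⟨w, fun m hm => (hm ?_).elim⟩
    exact (hw.le_of_le (Set.mem_univ _) inf_le_left).trans inf_le_right
  refine ⟨x, Set.Subset.antisymm (fun m hm => ?_) hx.prop⟩
  -- The event `m` comes from a cover `u ⋖ v` whose sets both lie in `X`, so maximality of `x` gives
  -- `v ≤ x`.
  obtain ⟨Y, ⟨⟨u, v, huv, hum, hvm, rfl⟩, -⟩, hYX⟩ := hX m hm
  have hv : infIrredsNotAbove v ⊆ X := by
    rw [infIrredsNotAbove_of_covBy hL huv hum hvm]
    exact Set.insert_subset hm hYX
  have hvx : x ⊔ v ≤ x := hx.le_of_ge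
    (show infIrredsNotAbove (x ⊔ v) ⊆ X from
      (infIrredsNotAbove_sup x v).trans_subset (Set.union_subset hx.prop hv)) le_sup_left
  exact fun hxm => hvm ((le_sup_right.trans hvx).trans hxm)

theorem nonempty_rdp_latticeDSC_orderIso (hL : IsSemimodularM3Free L) :
    Nonempty ((latticeDSC L).Rdp ≃o L) := by
  let f : L ↪o (latticeDSC L).Rdp := OrderEmbedding.ofMapLEIff
    (fun x => DSC.mkRdp (infIrredsNotAbove x) (isComplete_infIrredsNotAbove x))
    fun x y => DSC.rdp_le_iff.trans infIrredsNotAbove_subset_iff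
  refine ⟨(RelIso.ofSurjective f fun X => ?_).symm⟩
  obtain ⟨x, hx⟩ := exists_eq_infIrredsNotAbove hL (DSC.rdp_isComplete X)
  exact ⟨x, Subtype.ext hx.symm⟩

end

/-! ### Recovering a DSC from its poset. -/

namespace DSC

variable {D : DSC.{u}} {e : D.Event}

/-- The largest reachable set of events that avoids `e`. -/
def avoid (e : D.Event) : D.Rdp := mkRdp (D.core {e}ᶜ) isComplete_core

theorem mem_iff_not_le_avoid {A : D.Rdp} : e ∈ A.1 ↔ ¬ A ≤ avoid e := by
  rw [rdp_le_iff]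
  refine ⟨fun he h => core_subset (h he) rfl, fun h => ?_⟩
  by_contra he
  exact h (subset_core (rdp_isComplete A) (Set.subset_compl_singleton_iff.2 he))

theorem notMem_avoid : e ∉ (avoid e).1 := fun h => mem_iff_not_le_avoid.1 h le_rfl

/-- By maximality, the only event that can be added to `avoid e` is `e` itself. -/
theorem isComplete_insert_of_avoid_lt {A : D.Rdp} (h : avoid e < A) :
    e ∈ A.1 ∧ D.IsComplete (insert e (avoid e).1) := by
  obtain ⟨f, hfA, hf, hc⟩ :=
    exists_isComplete_insert (rdp_isComplete (avoid e)) (rdp_isComplete A) (rdp_lt_iff.1 h)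
  obtain rfl : e = f := by
    by_contra hef
    refine hf (rdp_le_iff.1 (?_ : mkRdp _ hc ≤ avoid e) (Set.mem_insert _ _))
    by_contra hle
    rcases mem_iff_not_le_avoid.2 hle with h | h
    exacts [hef h, notMem_avoid h]
  exact ⟨hfA, hc⟩

theorem avoid_lt_univ : avoid e < mkRdp Set.univ isComplete_univ :=
  rdp_lt_iff.2 ((Set.subset_univ _).ssubset_of_mem_notMem (Set.mem_univ e) notMem_avoid)

theorem isComplete_insert_avoid : D.IsComplete (insert e (avoid e).1) :=
  (isComplete_insert_of_avoid_lt avoid_lt_univ).2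

theorem avoid_covBy : avoid e ⋖ mkRdp _ (isComplete_insert_avoid (e := e)) :=
  rdp_covBy_of_eq_insert notMem_avoid rfl

theorem infIrred_avoid : InfIrred (avoid e) := by
  refine ⟨fun h => avoid_lt_univ.not_ge (h avoid_lt_univ.le), fun b c hbc => ?_⟩
  by_contra! hne
  have key : ∀ d : D.Rdp, avoid e ≤ d → d ≠ avoid e → mkRdp _ isComplete_insert_avoid ≤ d :=
    fun d hd hne => rdp_le_iff.2 (Set.insert_subset
      (isComplete_insert_of_avoid_lt (lt_of_le_of_ne hd hne.symm)).1 (rdp_le_iff.1 hd))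
  exact (avoid_covBy (e := e)).lt.not_ge ((le_inf (key b (hbc ▸ inf_le_left) hne.1)
    (key c (hbc ▸ inf_le_right) hne.2)).trans hbc.le)

theorem avoid_injective : Function.Injective (avoid (D := D)) := by
  intro e f h
  have hle : ¬ mkRdp _ (isComplete_insert_avoid (e := f)) ≤ avoid e := by
    rw [h]
    exact avoid_covBy.lt.not_ge
  have : e ∈ insert f (avoid f).1 := mem_iff_not_le_avoid.2 hle
  rw [← h] at this
  exact this.resolve_right notMem_avoid

/-- If `e` can be added to `A`, then `A ≤ avoid e`. A strict inequality would put the unique upper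
cover of `A`, which contains `e`, below `avoid e`. -/
theorem exists_avoid_eq {A : D.Rdp} (hA : InfIrred A) : ∃ e, avoid e = A := by
  have hlt : A < mkRdp Set.univ isComplete_univ :=
    lt_of_le_of_ne (rdp_le_iff.2 (Set.subset_univ _)) fun h => hA.1 fun B _ => by
      rw [h]
      exact rdp_le_iff.2 (Set.subset_univ _)
  obtain ⟨e, -, heA, hc⟩ :=
    exists_isComplete_insert (rdp_isComplete A) isComplete_univ (rdp_lt_iff.1 hlt)
  have hle : A ≤ avoid e := by
    by_contra h
    exact heA (mem_iff_not_le_avoid.2 h)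
  refine ⟨e, ?_⟩
  by_contra hne
  obtain ⟨B, hAB, hB⟩ := exists_covBy_le_of_lt (lt_of_le_of_ne hle (Ne.symm hne))
  have hAe : A ⋖ mkRdp _ hc := rdp_covBy_of_eq_insert heA rfl
  rw [hA.eq_of_covBy hAB hAe] at hB
  exact notMem_avoid (rdp_le_iff.1 hB (Set.mem_insert _ _))

/-- Events correspond to meet-irreducible elements of the reachable dependency poset. -/
noncomputable def eventEquivInfIrred (D : DSC.{u}) : D.Event ≃ {A : D.Rdp // InfIrred A} :=
  Equiv.ofBijective (fun e => ⟨avoid e, infIrred_avoid⟩)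
    ⟨fun _ _ h => avoid_injective (congrArg Subtype.val h), fun A =>
      (exists_avoid_eq A.2).imp fun _ h => Subtype.ext h⟩

theorem infIrred_orderIso {L L' : Type u} [Lattice L] [Lattice L'] (φ : L ≃o L') {m : L} :
    InfIrred m ↔ InfIrred (φ m) := by
  have key : ∀ {L L' : Type u} [Lattice L] [Lattice L'] (φ : L ≃o L') {m : L},
      InfIrred m → InfIrred (φ m) := by
    intro L L' _ _ φ m h
    refine ⟨fun hmax => h.1 fun b hb => φ.le_iff_le.1 (hmax (φ.monotone hb)), fun b c hbc => ?_⟩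
    have hm : φ.symm b ⊓ φ.symm c = m := by rw [← φ.symm.map_inf, hbc, φ.symm_apply_apply]
    simpa only [φ.symm_apply_eq] using h.2 hm
  refine ⟨key φ, fun h => ?_⟩
  simpa using key φ.symm h

/-- Matching meet-irreducibles gives a bijection of events. Membership is read off from `avoid`, so
the isomorphism acts on complete sets as the image under that bijection. -/
theorem equivUpToRenaming_of_orderIso {D D' : DSC.{u}} (φ : D.Rdp ≃o D'.Rdp) :
    D.EquivUpToRenaming D' := by
  let σ : D.Event ≃ D'.Event := (eventEquivInfIrred D).trans
    ((φ.toEquiv.subtypeEquiv fun _ => infIrred_orderIso φ).trans (eventEquivInfIrred D').symm)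
  have hσ : ∀ e, avoid (σ e) = φ (avoid e) := fun e =>
    congrArg Subtype.val ((eventEquivInfIrred D').apply_symm_apply
      ⟨φ (avoid e), (infIrred_orderIso φ).1 infIrred_avoid⟩)
  have hφ : ∀ A : D.Rdp, (φ A).1 = σ '' A.1 := fun A => by
    ext f
    obtain ⟨e, rfl⟩ := σ.surjective f
    rw [σ.injective.mem_set_image, mem_iff_not_le_avoid, mem_iff_not_le_avoid, hσ, φ.le_iff_le]
  have hc : ∀ X : Set D.Event, D'.IsComplete (σ '' X) ↔ D.IsComplete X := fun X => by
    refine ⟨fun h => ?_, fun h => hφ (mkRdp X h) ▸ rdp_isComplete _⟩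
    have := hφ (φ.symm (mkRdp _ h))
    rw [φ.apply_symm_apply] at this
    rw [σ.injective.image_injective this]
    exact rdp_isComplete _
  refine ⟨σ, fun e X => ?_⟩
  rw [sat_iff_exists_isComplete_insert, sat_iff_exists_isComplete_insert]
  constructor
  · rintro ⟨Z, hZX, h1, h2, h3⟩
    refine ⟨σ '' Z, Set.image_mono hZX, (hc Z).2 h1, ?_, ?_⟩
    · rwa [σ.injective.mem_set_image]
    · rwa [← Set.image_insert_eq, hc]
  · rintro ⟨Z', hZX, h1, h2, h3⟩
    obtain ⟨Z, rfl⟩ := σ.surjective.image_surjective Z'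
    rw [σ.injective.mem_set_image] at h2
    rw [← Set.image_insert_eq, hc] at h3
    exact ⟨Z, (Set.image_subset_image_iff σ.injective).1 hZX, (hc Z).1 h1, h2, h3⟩

/-- Without redundancy the predicate determines the dependency sets, which upgrades equivalence to
renaming. -/
theorem Irredundant.mem_dep_iff (hD : D.Irredundant) {X : Set D.Event} :
    X ∈ D.dep e ↔ Minimal (D.Sat e) X := by
  constructor
  · refine fun hX => ⟨⟨X, hX, subset_rfl⟩, ?_⟩
    rintro Y ⟨Z, hZ, hZY⟩ hYX
    rw [← (hD e).eq hZ hX (hZY.trans hYX)]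
    exact hZY
  · rintro ⟨⟨Y, hY, hYX⟩, hmin⟩
    rwa [hYX.antisymm (hmin ⟨Y, hY, subset_rfl⟩ hYX)] at hY

theorem EquivUpToRenaming.isRenaming {D D' : DSC.{u}} (h : D.EquivUpToRenaming D')
    (hD : D.Irredundant) (hD' : D'.Irredundant) : D.IsRenaming D' := by
  obtain ⟨σ, hσ⟩ := h
  refine ⟨σ, fun e => ?_⟩
  ext X'
  obtain ⟨X, rfl⟩ := σ.surjective.image_surjective X'
  rw [σ.injective.image_injective.mem_set_image, hD.mem_dep_iff, hD'.mem_dep_iff]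
  refine and_congr (hσ e X).symm ?_
  rw [σ.surjective.image_surjective.forall]
  refine forall_congr' fun Y => ?_
  rw [← hσ e Y]
  exact imp_congr_right fun _ => imp_congr (Set.image_subset_image_iff σ.injective)
    (Set.image_subset_image_iff σ.injective)

end DSC

theorem mainTheorem1 :
    -- `rdp` lands in the finite upper semimodular `M₃`-free lattices, and these fail to be
    -- distributive exactly by containing `S₇`, hence by failing to be modular
    (∀ D : DSC.{u}, IsSemimodularM3Free D.Rdp ∧
      (¬ IsDistributiveLattice D.Rdp ↔ HasCoverPreservingS7 D.Rdp) ∧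
      (¬ IsDistributiveLattice D.Rdp → ¬ IsModularLattice D.Rdp)) ∧
    ∃ uds : (L : Type u) → [Lattice L] → [Finite L] → [Nonempty L] →
        IsSemimodularM3Free L → DSC.{u},
      -- `uds` is defined on lattices up to isomorphism, with irredundant values
      (∀ (L : Type u) [Lattice L] [Finite L] [Nonempty L] (hL : IsSemimodularM3Free L),
        (uds L hL).Irredundant) ∧
      (∀ (L L' : Type u) [Lattice L] [Finite L] [Nonempty L] [Lattice L'] [Finite L']
        [Nonempty L'] (hL : IsSemimodularM3Free L) (hL' : IsSemimodularM3Free L'),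
        Nonempty (L ≃o L') → (uds L hL).IsRenaming (uds L' hL')) ∧
      -- `rdp ∘ uds` is the identity
      (∀ (L : Type u) [Lattice L] [Finite L] [Nonempty L] (hL : IsSemimodularM3Free L),
        Nonempty ((uds L hL).Rdp ≃o L)) ∧
      -- `uds ∘ rdp` is the identity up to renaming
      (∀ (D : DSC.{u}) (hD : IsSemimodularM3Free D.Rdp),
        (uds D.Rdp hD).EquivUpToRenaming D ∧
        (D.Irredundant → (uds D.Rdp hD).IsRenaming D)) := by
  refine ⟨fun D => ⟨⟨D.isUpperModularLattice_rdp, D.not_hasM3Sublattice_rdp⟩,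
    ⟨DSC.hasCoverPreservingS7_rdp, fun h => h.not_isDistributiveLattice⟩,
    fun h => (DSC.hasCoverPreservingS7_rdp h).not_isModularLattice⟩,
    fun L _ _ _ _ => latticeDSC L, fun L _ _ _ _ => latticeDSC_irredundant, ?_,
    fun L _ _ _ hL => nonempty_rdp_latticeDSC_orderIso hL, ?_⟩
  · rintro L L' _ _ _ _ _ _ hL hL' ⟨φ⟩
    obtain ⟨ψ⟩ := nonempty_rdp_latticeDSC_orderIso hL
    obtain ⟨ψ'⟩ := nonempty_rdp_latticeDSC_orderIso hL'
    exact (DSC.equivUpToRenaming_of_orderIso ((ψ.trans φ).trans ψ'.symm)).isRenaming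
      latticeDSC_irredundant latticeDSC_irredundant
  · intro D hD
    obtain ⟨ψ⟩ := nonempty_rdp_latticeDSC_orderIso hD
    have h := DSC.equivUpToRenaming_of_orderIso ψ
    exact ⟨h, h.isRenaming latticeDSC_irredundant⟩
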